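/- **Notation.** Let $T$ be a complete first order theory in a vocabulary $\tau_T$, and let $|T|$ be the number of first order formulas of $\tau_T$. For cardinals, $\lambda^{<\lambda}=\sup_{\mu<\lambda}\lambda^{\mu}$. A formula $\varphi(\bar x,\bar y)$ of $\tau_T$, with $\bar y$ a nonempty finite tuple of variables, has the *strong independence property* for $T$ if for every model $M$ of $T$ and all disjoint finite sets $I_1,I_2$ of $\ell g(\bar y)$-tuples from $M$ there is a tuple $\bar a$ from $M$ such that $M\models\neg\varphi[\bar a,\bar b]$ for $\bar b\in I_1$ and $M\models\varphi[\bar a,\bar b]$ for $\bar b\in I_2$. $T$ is *strongly independent* if some formula has this property. For models $M\prec N$, the pair $(N,M)$ is the model $N$ with a predicate for the universe of $M$; so $(N,M)\cong(N',M')$ means that some isomorphism of $N$ onto $N'$ maps $M$ onto $M'$. Let $\lambda$ be a regular uncountable cardinal and $N_1\prec N_2$ models of $T$ of cardinality $\lambda$. For a one-to-one $f:N_2\to\lambda$ and $\delta<\lambda$ let $\mathrm{inv}^\varphi_5(\delta,f,N_1,N_2)$ be the set of all $\mathscr P\subseteq\mathscr P(\delta)$ for which there are tuples $\bar a_\gamma\in{}^{\ell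 g(\bar x)}N_2$ $(\gamma<\delta)$ with $f(\bar a_\gamma)\in{}^{\ell g(\bar x)}\delta$ such that, for every $\mathscr U\subseteq\delta$, $\mathscr U\in\mathscr P$ if and only if there is $\bar b\in{}^{\ell g(\bar y)}N_1$ such that for all $\gamma<\delta$: $N_2\models\varphi[\bar a_\gamma,\bar b]\iff\gamma\in\mathscr U$. Let $\mathrm{inv}^\varphi_6(N_1,N_2)$ be the class of $\langle\mathrm{inv}^\varphi_5(\delta,f,N_1,N_2):\delta<\lambda\rangle$ modulo the club filter on $\lambda$; it does not depend on $f$. **Theorem.** Let $T$ be a complete, strongly independent first order theory, and let $\lambda=\lambda^{<\lambda}$ be a regular uncountable cardinal with $\lambda>|T|$ and $\lambda^+=2^\lambda$. (1) Let $M$ be a saturated model of $T$ of cardinality $\lambda^+$, and let $\langle M_\alpha:\alpha<\lambda^+\rangle$ be a $\prec$-increasing continuous sequence of models of cardinality $\lambda$ with union $M$. Then there are a formula $\varphi$ with the strong independence property for $T$ and a club $E$ of $\lambda^+$ such that for all $\delta_1<\delta_2<\delta_3$ in $E$ of cofinality $\lambda$, $$(M_{\delta_2},M_{\delta_1})\not\cong(M_{\delta_3},M_{\delta_1}),\quad\text{and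 moreover}\quad \mathrm{inv}^\varphi_6(M_{\delta_1},M_{\delta_2})\neq\mathrm{inv}^\varphi_6(M_{\delta_1},M_{\delta_3}).$$ Consequently the generic pair property fails: there is no club $E$ of $\lambda^+$ such that all pairs $(M_\beta,M_\alpha)$ with $\alpha<\beta$ in $E$ of cofinality $\lambda$ are isomorphic to each other. (2) If $M\prec N_0$ are models of $T$ of cardinality $\lambda$, then there is an elementary extension $N_1$ of $N_0$ of cardinality $\lambda$ such that $(N_0,M)\not\cong(N_2,M)$ for every elementary extension $N_2$ of $N_1$ of cardinality $\lambda$. -/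

import Mathlib

universe u

open FirstOrder Cardinal Order

namespace GenericPair

section ModelTheory

variable {L : FirstOrder.Language.{u, u}}

/-- The formula `φ(x̄, ȳ)`, with `x̄` of length `n` and `ȳ` a nonempty tuple of length `m`, has the
strong independence property for `T`: in every model of `T`, any two disjoint finite sets `I₁`, `I₂`
of `m`-tuples are separated by an instance `φ(ā, -)`, false on `I₁` and true on `I₂`. -/
def HasStrongIndependenceProperty (T : L.Theory) {n m : ℕ} (φ : L.Formula (Fin n ⊕ Fin m)) : Prop :=
  0 < m ∧ ∀ (M : Type u) [L.Structure M] [M ⊨ T] [Nonempty M] (I₁ I₂ : Finset (Fin m → M)),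
    Disjoint I₁ I₂ →
      ∃ a : Fin n → M, (∀ b ∈ I₁, ¬ φ.Realize (Sum.elim a b)) ∧ ∀ b ∈ I₂, φ.Realize (Sum.elim a b)

/-- `T` is strongly independent: some formula has the strong independence property for `T`. -/
def StronglyIndependent (T : L.Theory) : Prop :=
  ∃ (n m : ℕ) (φ : L.Formula (Fin n ⊕ Fin m)), HasStrongIndependenceProperty T φ

variable (L) in
/-- `M` is saturated: every set of formulas in one variable, with parameters from a set `A ⊆ M` of
cardinality `< |M|`, that is finitely satisfiable in `M` is realized in `M`. -/
def IsSaturated (M : Type u) [L.Structure M] : Prop :=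
  ∀ A : Set M, #A < #M → ∀ p : Set (L[[A]].Formula Unit),
    (∀ s : Finset (L[[A]].Formula Unit), ↑s ⊆ p → ∃ x : M, ∀ ψ ∈ s, ψ.Realize fun _ => x) →
      ∃ x : M, ∀ ψ ∈ p, ψ.Realize fun _ => x

variable (L) in
/-- The pairs `(N, A)` and `(N', A')` of a structure with a distinguished subset are isomorphic. -/
def PairIso (N N' : Type u) [L.Structure N] [L.Structure N'] (A : Set N) (A' : Set N') : Prop :=
  ∃ e : N ≃[L] N', e '' A = A'

/-- `⟨M_α : α < lam⁺⟩` is a `≺`-increasing continuous sequence of models of cardinality `lam` with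
union `M`. (By the elementary chain theorem all members of such a sequence are elementary in the
union, and for elementary submodels of `M` the relations `≺` and `⊆` agree.) -/
structure IsFiltration {M : Type u} [L.Structure M] (lam : Cardinal.{u})
    (Mc : (succ lam).ord.ToType → L.ElementarySubstructure M) : Prop where
  card_eq : ∀ α, #(Mc α) = lam
  increasing : ∀ α β, α ≤ β → (Mc α : Set M) ⊆ Mc β
  continuous : ∀ δ, IsSuccLimit δ → (Mc δ : Set M) = ⋃ α ∈ Set.Iio δ, (Mc α : Set M)
  union_eq : (⋃ α, (Mc α : Set M)) = Set.univ

/-- The universe of `A` as a subset of `B`; used for `A ≺ B ≺ M`. -/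
def within {M : Type u} [L.Structure M] (A B : L.ElementarySubstructure M) : Set B :=
  {x | (x : M) ∈ A}

/-- The generic pair property, read in the filtration `⟨M_α : α < lam⁺⟩`: for some club `E` of
`lam⁺`, all pairs `(M_β, M_α)` with `α < β` in `E` of cofinality `lam` are isomorphic. -/
def GenericPairProperty {M : Type u} [L.Structure M] (lam : Cardinal.{u})
    (Mc : (succ lam).ord.ToType → L.ElementarySubstructure M) : Prop :=
  ∃ E : Set (succ lam).ord.ToType, IsClub E ∧
    ∀ α ∈ E, ∀ β ∈ E, ∀ α' ∈ E, ∀ β' ∈ E, α < β → α' < β' →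
      cof (Set.Iio α) = lam → cof (Set.Iio β) = lam →
      cof (Set.Iio α') = lam → cof (Set.Iio β') = lam →
        PairIso L (Mc β) (Mc β') (within (Mc α) (Mc β)) (within (Mc α') (Mc β'))

end ModelTheory

section ClubFilter

/-- The filter generated by the club subsets of a linear order. -/
def clubFilter (α : Type u) [LinearOrder α] : Filter α :=
  Filter.generate {C | IsClub C}

/-- On a well-order of cofinality other than `ℵ₀`, e.g. a regular uncountable cardinal, the sets of
the club filter are exactly the sets that include a club. -/
theorem mem_clubFilter_iff {α : Type u} [LinearOrder α] [WellFoundedLT α] (hα : cof α ≠ ℵ₀)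
    {S : Set α} : S ∈ clubFilter α ↔ ∃ C, IsClub C ∧ C ⊆ S := by
  constructor
  · intro h
    induction h with
    | basic h => exact ⟨_, h, subset_rfl⟩
    | univ => exact ⟨Set.univ, IsClub.univ, subset_rfl⟩
    | superset _ hst ih => exact ih.imp fun C hC => ⟨hC.1, hC.2.trans hst⟩
    | inter _ _ ih₁ ih₂ =>
      obtain ⟨C, hC, hCs⟩ := ih₁
      obtain ⟨D, hD, hDs⟩ := ih₂
      exact ⟨C ∩ D, IsClub.inter hα hC hD, Set.inter_subset_inter hCs hDs⟩
  · rintro ⟨C, hC, hCS⟩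
    exact Filter.mem_of_superset (Filter.GenerateSets.basic hC) hCS

end ClubFilter

section Invariants

variable {L : FirstOrder.Language.{u, u}} {N : Type u} [L.Structure N] {n m : ℕ}

/-- The invariant `inv₅^φ(δ, f, N₁, N)` for a submodel `N₁` (given by its universe) of `N`, an
injection `f` of `N` into `lam` and `δ < lam`. It is the set of all families `P` of subsets of `δ`
for which there are `n`-tuples `a_γ` (`γ < δ`) from `N` with `f(a_γ)` in `δ` such that a subset `U`
of `δ` is in `P` iff for some `m`-tuple `b` from `N₁`, for all `γ < δ`: `N ⊨ φ(a_γ, b)` iff `γ ∈ U`.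
Ordinals below `lam` are the elements of `lam.ord.ToType`; `δ` is identified with `Set.Iio δ`. -/
noncomputable def inv5 {lam : Cardinal.{u}} (φ : L.Formula (Fin n ⊕ Fin m)) (δ : lam.ord.ToType)
    (f : N → lam.ord.ToType) (N₁ : Set N) : Set (Set (Set lam.ord.ToType)) :=
  {P | (∀ U ∈ P, U ⊆ Set.Iio δ) ∧
    ∃ a : Set.Iio δ → Fin n → N, (∀ γ i, f (a γ i) < δ) ∧
      ∀ U, U ⊆ Set.Iio δ →
        (U ∈ P ↔ ∃ b : Fin m → N, (∀ i, b i ∈ N₁) ∧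
          ∀ γ : Set.Iio δ, (φ.Realize (Sum.elim (a γ) b) ↔ (γ : lam.ord.ToType) ∈ U))}

/-- The invariant `inv₆^φ(N₁, N)`, computed with the injection `f` of `N` into `lam`: the class of
`⟨inv₅^φ(δ, f, N₁, N) : δ < lam⟩` modulo the club filter on `lam`. For regular uncountable `lam` it
does not depend on `f`. -/
noncomputable def inv6 {lam : Cardinal.{u}} (φ : L.Formula (Fin n ⊕ Fin m)) (f : N → lam.ord.ToType)
    (N₁ : Set N) : (clubFilter lam.ord.ToType).Germ (Set (Set (Set lam.ord.ToType))) :=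
  ((fun δ => inv5 φ δ f N₁ : lam.ord.ToType → Set (Set (Set lam.ord.ToType))) :
    (clubFilter lam.ord.ToType).Germ (Set (Set (Set lam.ord.ToType))))

end Invariants

end GenericPair

/-!
The invariants of two pairs are told apart by a diagonal argument. Fix a formula `φ(x̄, ȳ)` with the
strong independence property, and a pair `(N, N₁)` of models of cardinality `lam`.

* For `δ < lam` infinite, `inv₅` of `(N, N₁)` at `δ` has at most `2 ^ |δ|` members, since a member
  is given by `|δ|` many tuples with images in `δ` (`mk_inv5_le`). Hence it cannot contain all
  families of subsets of `δ`, and one can diagonalize at stationarily many `δ` at once: there is one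
  family `F` of at most `lam` subsets of `lam` whose trace `{U ∩ δ : U ∈ F}` is not in `inv₅` of
  `(N, N₁)` at `δ`, for stationarily many `δ` (`exists_family_trace_notMem`). The members of `F` are bounded, so that
  `lam ^< lam = lam` bounds their number.
* Index `F` by the `m`-tuples `b` of `N₁`, say `F = {s b}`. If an extension `N'` contains tuples
  `a γ`, `γ < lam`, with `φ(a γ, b) ↔ γ ∈ s b`, then the trace of `F` on `δ` is in `inv₅` of
  `(N', N₁)` for a club of `δ`, so that `(N, N₁)` and `(N', N₁)` have different `inv₆`
  (`exists_assignment_inv6_ne`). As `inv₆` is an isomorphism invariant (`inv6_eq_of_equiv`), the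
  pairs are not isomorphic.
* By strong independence the conditions on each single `a γ` are finitely satisfiable, whatever `s`
  is. So `a γ` exists in every sufficiently saturated model
  (`HasStrongIndependenceProperty.exists_realize_iff_of_isSaturated`), and in an elementary
  extension of the same cardinality (`HasStrongIndependenceProperty.exists_elementaryEmbedding_realize_iff`);
  the conditions for different `γ` are unrelated.

In a filtration of a saturated model, for `α < β` all these tuples for `(M_β, M_α)` lie in some
`M_ξ`, and the required club consists of the points closed under `(α, β) ↦ ξ`.
-/

namespace GenericPair

/-! ### Clubs and ladders -/

section Clubs

variable {Λ : Type u} [LinearOrder Λ]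

theorem exists_forall_lt_of_mk_lt_cof {s : Set Λ} (h : #s < cof Λ) : ∃ x, ∀ y ∈ s, y < x :=
  not_isCofinal_iff.1 fun h' => (cof_le h').not_gt h

theorem exists_mem_isClub_gt (hΛ : ℵ₀ < cof Λ) {C : Set Λ} (hC : IsClub C) (x : Λ) :
    ∃ y ∈ C, x < y := by
  obtain ⟨y, hy⟩ := exists_forall_lt_of_mk_lt_cof (s := {x}) (by simpa using one_lt_aleph0.trans hΛ)
  obtain ⟨z, hz, hyz⟩ := hC.isCofinal y
  exact ⟨z, hz, (hy x rfl).trans_le hyz⟩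

/-- `D` is a ladder for `δ`: an infinite subset of `δ`, only finitely many members of which lie
below any given point below `δ`; that is, a cofinal subset of `δ` of order type `ω`. -/
def IsLadder (D : Set Λ) (δ : Λ) : Prop :=
  D ⊆ Set.Iio δ ∧ D.Infinite ∧ ∀ x < δ, (D ∩ Set.Iio x).Finite

theorem IsLadder.eq_of_subset {D D' : Set Λ} {δ δ' : Λ} (h : IsLadder D δ) (h' : IsLadder D' δ')
    (hsub : D' ⊆ D) (hle : δ' ≤ δ) : δ' = δ := by
  by_contra hne
  exact h'.2.1 ((h.2.2 δ' (hle.lt_of_ne hne)).subset fun x hx => ⟨hsub hx, h'.1 hx⟩)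

variable [WellFoundedLT Λ]

theorem exists_isLUB_of_forall_lt {s : Set Λ} {x : Λ} (h : ∀ y ∈ s, y < x) : ∃ a, IsLUB s a := by
  obtain ⟨a, ha, hmin⟩ := (wellFounded_lt (α := Λ)).has_min (upperBounds s)
    ⟨x, fun y hy => (h y hy).le⟩
  exact ⟨a, ha, fun b hb => not_lt.1 (hmin b hb)⟩

/-- A strictly increasing `ω`-sequence in an order of uncountable cofinality has a supremum, and
each member of the sequence is strictly below it. -/
theorem exists_isLUB_range_of_strictMono (hΛ : ℵ₀ < cof Λ) {g : ℕ → Λ} (hg : StrictMono g) :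
    ∃ δ, IsLUB (Set.range g) δ ∧ (∀ k, g k < δ) ∧ ∀ x < δ, ∃ k, x < g k := by
  obtain ⟨x, hx⟩ := exists_forall_lt_of_mk_lt_cof (s := Set.range g)
    ((Set.countable_range g).le_aleph0.trans_lt hΛ)
  obtain ⟨δ, hδ⟩ := exists_isLUB_of_forall_lt hx
  refine ⟨δ, hδ, fun k => (hg k.lt_succ_self).trans_le (hδ.1 ⟨_, rfl⟩), fun x hx => ?_⟩
  obtain ⟨_, ⟨k, rfl⟩, hk⟩ := (lt_isLUB_iff hδ).1 hx
  exact ⟨k, hk⟩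

/-- In a regular uncountable order, the points closed under a set-valued operation with small
values form a club. -/
theorem isClub_setOf_closed (hΛ : ℵ₀ < cof Λ) (hI : ∀ x : Λ, #(Set.Iio x) < cof Λ)
    (H : Λ → Set Λ) (hH : ∀ x, #(H x) < cof Λ) :
    IsClub {δ : Λ | ∀ x < δ, ∀ y ∈ H x, y < δ} := by
  refine ⟨fun d hd _ _ a ha x hx y hy => ?_, fun a => ?_⟩
  · obtain ⟨z, hz, hxz⟩ := (lt_isLUB_iff ha).1 hx
    exact (hd hz x hxz y hy).trans_le (ha.1 hz)
  · choose h hh using fun x => exists_forall_lt_of_mk_lt_cof (hH x)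
    have hnext : ∀ x : Λ, ∃ y, x < y ∧ ∀ z < x, h z < y := by
      intro x
      have : #(insert x (h '' Set.Iio x) : Set Λ) < cof Λ := by
        refine (mk_insert_le).trans_lt (add_lt_of_lt hΛ.le (mk_image_le.trans_lt (hI x)) ?_)
        exact one_lt_aleph0.trans hΛ
      obtain ⟨y, hy⟩ := exists_forall_lt_of_mk_lt_cof this
      exact ⟨y, hy x (Set.mem_insert _ _), fun z hz => hy _ (Set.mem_insert_of_mem _ ⟨z, hz, rfl⟩)⟩
    choose next hlt hnext using hnext
    obtain ⟨δ, -, hδ, hδ'⟩ := exists_isLUB_range_of_strictMono hΛ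
      (g := fun k => next^[k] a) (strictMono_nat_of_lt_succ fun k => by
        rw [Function.iterate_succ_apply']; exact hlt _)
    refine ⟨δ, fun x hx y hy => ?_, (hδ 0).le⟩
    obtain ⟨k, hk⟩ := hδ' x hx
    refine (hh x y hy).trans ((hnext _ x hk).trans ?_)
    have := hδ (k + 1)
    rwa [Function.iterate_succ_apply'] at this

theorem isClub_setOf_forall_map_lt (hΛ : ℵ₀ < cof Λ) (hI : ∀ x : Λ, #(Set.Iio x) < cof Λ)
    (h : Λ → Λ) : IsClub {δ : Λ | ∀ x < δ, h x < δ} := by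
  simpa using isClub_setOf_closed hΛ hI (fun x => {h x}) fun x => by
    simpa using one_lt_aleph0.trans hΛ

/-- If `K` is a well-order without maximum, of cardinality less than the cofinality of `Λ`, then
every club of `Λ` has arbitrarily large points of the same cofinality as `K`. -/
theorem exists_mem_isClub_cof_Iio_eq {K : Type u} [LinearOrder K] [WellFoundedLT K] [NoMaxOrder K]
    [Nonempty K] (hΛ : ℵ₀ < cof Λ) (hK : #K < cof Λ) {C : Set Λ} (hC : IsClub C) (a : Λ) :
    ∃ δ ∈ C, a < δ ∧ cof (Set.Iio δ) = cof K := by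
  have hstep : ∀ s : Set Λ, #s < cof Λ → ∃ y ∈ C, a < y ∧ ∀ z ∈ s, z < y := by
    intro s hs
    obtain ⟨x, hx⟩ := exists_forall_lt_of_mk_lt_cof (s := insert a s)
      ((mk_insert_le).trans_lt (add_lt_of_lt hΛ.le hs (one_lt_aleph0.trans hΛ)))
    obtain ⟨y, hy, hxy⟩ := hC.isCofinal x
    exact ⟨y, hy, (hx a (Set.mem_insert _ _)).trans_le hxy,
      fun z hz => (hx z (Set.mem_insert_of_mem _ hz)).trans_le hxy⟩
  have hrec : ∃ g : K → Λ, ∀ k, g k ∈ C ∧ a < g k ∧ ∀ j < k, g j < g k := by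
    have := Nonempty.intro a
    choose! next hnext using hstep
    let g : K → Λ := (wellFounded_lt (α := K)).fix fun k ih =>
      next (Set.range fun j : Set.Iio k => ih j j.2)
    have hg : ∀ k, g k = next (Set.range fun j : Set.Iio k => g j) := fun k =>
      WellFounded.fix_eq _ _ _
    refine ⟨g, fun k => ?_⟩
    have := hnext (Set.range fun j : Set.Iio k => g j)
      ((mk_range_le.trans (mk_set_le _)).trans_lt hK)
    rw [← hg k] at this
    exact ⟨this.1, this.2.1, fun j hj => this.2.2 _ ⟨⟨j, hj⟩, rfl⟩⟩
  obtain ⟨g, hg⟩ := hrec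
  have hmono : StrictMono g := fun j k hjk => (hg k).2.2 j hjk
  obtain ⟨x, hx⟩ := exists_forall_lt_of_mk_lt_cof (s := Set.range g) (mk_range_le.trans_lt hK)
  obtain ⟨δ, hδ⟩ := exists_isLUB_of_forall_lt hx
  have hlt : ∀ k, g k < δ := fun k => by
    obtain ⟨l, hl⟩ := exists_gt k
    exact (hmono hl).trans_le (hδ.1 ⟨l, rfl⟩)
  obtain ⟨k₀⟩ := ‹Nonempty K›
  refine ⟨δ, hC.isLUB_mem (Set.range_subset_iff.2 fun k => (hg k).1) ⟨_, k₀, rfl⟩ hδ,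
    (hg k₀).2.1.trans (hlt k₀), ?_⟩
  refine (cof_congr_of_strictMono (f := fun k => (⟨g k, hlt k⟩ : Set.Iio δ))
    (fun j k hjk => hmono hjk) fun y => ?_).symm
  obtain ⟨_, ⟨k, rfl⟩, hk⟩ := (lt_isLUB_iff hδ).1 y.2
  exact ⟨_, ⟨k, rfl⟩, hk.le⟩

/-- The points that have a ladder form a stationary set. -/
theorem exists_mem_isClub_isLadder [Nonempty Λ] (hΛ : ℵ₀ < cof Λ) {C : Set Λ} (hC : IsClub C) :
    ∃ δ ∈ C, ∃ D, IsLadder D δ := by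
  choose next hmem hlt using exists_mem_isClub_gt hΛ hC
  inhabit Λ
  let g : ℕ → Λ := fun k => next^[k + 1] default
  have hg : StrictMono g := strictMono_nat_of_lt_succ fun k => by
    simp only [g, Function.iterate_succ_apply' next (k + 1)]; exact hlt _
  obtain ⟨δ, hδ, hδ₁, hδ₂⟩ := exists_isLUB_range_of_strictMono hΛ hg
  refine ⟨δ, hC.isLUB_mem (Set.range_subset_iff.2 fun k => ?_) (Set.range_nonempty g) hδ,
    Set.range g, Set.range_subset_iff.2 hδ₁, Set.infinite_range_of_injective hg.injective,
    fun x hx => ?_⟩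
  · simp only [g, Function.iterate_succ_apply']; exact hmem _
  · obtain ⟨k, hk⟩ := hδ₂ x hx
    refine ((Set.finite_Iio k).image g).subset ?_
    rintro _ ⟨⟨j, rfl⟩, hj⟩
    exact ⟨j, hg.lt_iff_lt.1 (hj.trans hk), rfl⟩

end Clubs

/-! ### Diagonalizing against traces -/

section Diagonal

variable {Λ : Type u} [LinearOrder Λ]

theorem mk_setOf_bounded_le [Infinite Λ] (hcard : ∀ x : Λ, 2 ^ #(Set.Iio x) ≤ #Λ) :
    #{U : Set Λ | ∃ x, U ⊆ Set.Iio x} ≤ #Λ := by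
  have : {U : Set Λ | ∃ x, U ⊆ Set.Iio x} = ⋃ x : Λ, 𝒫 (Set.Iio x) := by
    ext U; simp
  rw [this]
  refine (mk_iUnion_le _).trans ((mul_le_mul_right (ciSup_le' fun x => ?_) _).trans
    (mul_eq_self (aleph0_le_mk Λ)).le)
  rw [mk_powerset]
  exact hcard x

variable [WellFoundedLT Λ]

/-- Given at most `2 ^ |δ|` many collections of subsets of `δ` for every infinite `δ`, there is a
family of at most `|Λ|` subsets of `Λ` whose traces on `δ` are, for stationarily many `δ`, not among
the given collections.

This is Cantor's diagonal argument, made at all `δ` that have a ladder `lad δ` and are closed under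
an injection `c` of `Λ ⊕ Λ` into `Λ`. There each given `X` is coded by a set `g δ X ⊆ δ`, and `F`
omits `g δ X` from its trace on `δ` exactly when `g δ X ∈ X`. The ladder is part of `g δ X`: since
its proper initial segments are finite, `g δ X ∩ δ'` is never of the form `g δ' X'` for `δ' ≠ δ`, so
that the decisions at different `δ` do not interfere. -/
theorem exists_family_trace_notMem (hΛ : ℵ₀ < cof Λ) (hI : ∀ x : Λ, #(Set.Iio x) < cof Λ)
    (hcard : ∀ x : Λ, 2 ^ #(Set.Iio x) ≤ #Λ) (𝒳 : Λ → Set (Set (Set Λ)))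
    (h𝒳 : ∀ δ, (Set.Iio δ).Infinite → #(𝒳 δ) ≤ 2 ^ #(Set.Iio δ)) :
    ∃ F : Set (Set Λ), F.Nonempty ∧ #F ≤ #Λ ∧
      ∀ C, IsClub C → ∃ δ ∈ C, (fun U => U ∩ Set.Iio δ) '' F ∉ 𝒳 δ := by
  have hinf : Infinite Λ := infinite_iff.2 (hΛ.le.trans (cof_le_cardinalMk Λ))
  obtain ⟨c, hc⟩ : ∃ c : Λ ⊕ Λ → Λ, Function.Injective c := by
    have : #(Λ ⊕ Λ) ≤ #Λ := by simp
    obtain ⟨j⟩ := (Cardinal.le_def _ _).1 this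
    exact ⟨j, j.injective⟩
  have he : ∀ δ : Λ, ∃ e : Set (Set Λ) → Set Λ, (Set.Iio δ).Infinite →
      (∀ X ∈ 𝒳 δ, e X ⊆ Set.Iio δ) ∧ Set.InjOn e (𝒳 δ) := by
    intro δ
    by_cases hδ : (Set.Iio δ).Infinite
    · have := h𝒳 δ hδ
      rw [← mk_powerset] at this
      obtain ⟨j⟩ := (Cardinal.le_def _ _).1 this
      classical
      refine ⟨fun X => if h : X ∈ 𝒳 δ then j ⟨X, h⟩ else ∅, fun _ => ⟨fun X hX => ?_, ?_⟩⟩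
      · simp only [hX, dif_pos]
        exact (j ⟨X, hX⟩).2
      · intro X hX Y hY hXY
        simp only [hX, hY, dif_pos] at hXY
        simpa using j.injective (Subtype.ext hXY)
    · exact ⟨fun _ => ∅, fun h => absurd h hδ⟩
  choose e he using he
  classical
  let lad : Λ → Set Λ := fun δ => if h : ∃ D, IsLadder D δ then h.choose else ∅
  let S : Set Λ := {δ | IsLadder (lad δ) δ}
  have hSinf : ∀ δ ∈ S, (Set.Iio δ).Infinite := fun δ hδ => hδ.2.1.mono hδ.1
  let g : Λ → Set (Set Λ) → Set Λ := fun δ X => c '' (Sum.inl '' e δ X ∪ Sum.inr '' lad δ)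
  have hginr : ∀ δ X x, c (Sum.inr x) ∈ g δ X ↔ x ∈ lad δ := by
    intro δ X x; simp [g, hc.eq_iff]
  have hginl : ∀ δ X x, c (Sum.inl x) ∈ g δ X ↔ x ∈ e δ X := by
    intro δ X x; simp [g, hc.eq_iff]
  let F : Set (Set Λ) := {U | (∃ x, U ⊆ Set.Iio x) ∧
    ∀ δ ∈ S, ∀ X ∈ 𝒳 δ, U ∩ Set.Iio δ = g δ X → g δ X ∉ X}
  refine ⟨F, ⟨∅, ⟨(Classical.arbitrary Λ), Set.empty_subset _⟩, fun δ hδ X hX h => ?_⟩,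
    (mk_le_mk_of_subset fun U hU => hU.1).trans (mk_setOf_bounded_le hcard), fun C hC => ?_⟩
  · obtain ⟨x, hx⟩ := hδ.2.1.nonempty
    have : c (Sum.inr x) ∈ ∅ ∩ Set.Iio δ := h ▸ (hginr δ X x).2 hx
    exact absurd this.1 (Set.notMem_empty _)
  · have hC₁ := isClub_setOf_forall_map_lt hΛ hI fun x => c (Sum.inl x)
    have hC₂ := isClub_setOf_forall_map_lt hΛ hI fun x => c (Sum.inr x)
    obtain ⟨δ, ⟨hδC, hδ₁, hδ₂⟩, hlad⟩ :=
      exists_mem_isClub_isLadder hΛ (hC.inter hΛ.ne' (hC₁.inter hΛ.ne' hC₂))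
    have hδS : δ ∈ S := by
      have : lad δ = hlad.choose := dif_pos hlad
      simp only [S, Set.mem_ofPred_eq, this]
      exact hlad.choose_spec
    refine ⟨δ, hδC, fun hX => ?_⟩
    set X := (fun U => U ∩ Set.Iio δ) '' F with hXdef
    have hgsub : g δ X ⊆ Set.Iio δ := by
      rintro _ ⟨_, ⟨x, hx, rfl⟩ | ⟨x, hx, rfl⟩, rfl⟩
      · exact hδ₁ x ((he δ (hSinf δ hδS)).1 X hX hx)
      · exact hδ₂ x (hδS.1 hx)
    by_cases hmem : g δ X ∈ X
    -- a member of the trace equal to `g δ X` was admitted to `F` only if `g δ X ∉ X`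
    · obtain ⟨U, hU, hUX⟩ := id hmem
      exact hU.2 δ hδS X hX hUX hmem
    -- conversely nothing keeps the bounded set `g δ X` out of `F`, at `δ` or at any other `δ'`
    · refine hmem ⟨g δ X, ⟨⟨δ, hgsub⟩, fun δ' hδ' X' hX' h => ?_⟩,
        Set.inter_eq_left.2 hgsub⟩
      have hsub : lad δ' ⊆ lad δ := fun x hx => by
        have : c (Sum.inr x) ∈ g δ X ∩ Set.Iio δ' := h ▸ (hginr δ' X' x).2 hx
        exact (hginr δ X x).1 this.1
      have hδδ' : δ' = δ := by
        rcases le_total δ' δ with hle | hle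
        · exact hδS.eq_of_subset hδ' hsub hle
        · rw [Set.inter_eq_left.2 (hgsub.trans (Set.Iio_subset_Iio hle))] at h
          refine (hδ'.eq_of_subset hδS (fun x hx => ?_) hle).symm
          exact (hginr δ' X' x).1 (h ▸ (hginr δ X x).2 hx)
      subst hδδ'
      rw [Set.inter_eq_left.2 hgsub] at h
      have : X = X' := (he δ' (hSinf _ hδS)).2 hX hX' (by
        ext x; rw [← hginl δ' X, ← hginl δ' X', h])
      rwa [← this]

end Diagonal

/-! ### The well-order of a regular cardinal -/

section RegularCardinal

variable {lam : Cardinal.{u}}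

theorem cof_ord_toType (hreg : lam.IsRegular) : cof lam.ord.ToType = lam := by
  rw [Ordinal.cof_toType, hreg.cof_ord]

theorem mk_Iio_lt_cof_ord_toType (hreg : lam.IsRegular) (x : lam.ord.ToType) :
    #(Set.Iio x) < cof lam.ord.ToType := by
  rw [cof_ord_toType hreg]
  simpa using mk_Iio_lt x (by simp)

theorem aleph0_lt_cof_ord_toType (hreg : lam.IsRegular) (hunc : ℵ₀ < lam) :
    ℵ₀ < cof lam.ord.ToType := by
  rwa [cof_ord_toType hreg]

theorem two_power_mk_Iio_le (hunc : ℵ₀ < lam) (hpow : lam ^< lam = lam) (x : lam.ord.ToType) :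
    2 ^ #(Set.Iio x) ≤ #lam.ord.ToType := by
  rw [mk_ord_toType]
  calc (2 : Cardinal) ^ #(Set.Iio x) ≤ lam ^ #(Set.Iio x) :=
        power_le_power_right ((natCast_lt_aleph0 (n := 2)).le.trans hunc.le)
    _ ≤ lam ^< lam := le_powerlt _ (by simpa using mk_Iio_lt x (by simp))
    _ = lam := hpow

end RegularCardinal

/-! ### The invariants of pairs -/

section Invariants

variable {L : FirstOrder.Language.{u, u}} {N N' : Type u} [L.Structure N] [L.Structure N']
  {n m : ℕ} {lam : Cardinal.{u}} (φ : L.Formula (Fin n ⊕ Fin m))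

/-- A member of `inv₅` at `δ` is determined by the tuples `a γ`, `γ < δ`, that witness it. As `f`
maps them into `δ`, there are at most `|δ| ^ |δ| = 2 ^ |δ|` choices. -/
theorem mk_inv5_le {f : N → lam.ord.ToType} (hf : Function.Injective f) (N₁ : Set N)
    {δ : lam.ord.ToType} (hδ : (Set.Iio δ).Infinite) :
    #(inv5 φ δ f N₁) ≤ 2 ^ #(Set.Iio δ) := by
  have hδ' : ℵ₀ ≤ #(Set.Iio δ) := infinite_iff.1 hδ.to_subtype
  let A := {a : Set.Iio δ → Fin n → N // ∀ γ i, f (a γ i) < δ}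
  let F : A → Set (Set lam.ord.ToType) := fun a => {U | U ⊆ Set.Iio δ ∧
    ∃ b : Fin m → N, (∀ i, b i ∈ N₁) ∧
      ∀ γ : Set.Iio δ, (φ.Realize (Sum.elim (a.1 γ) b) ↔ (γ : lam.ord.ToType) ∈ U)}
  have hF : inv5 φ δ f N₁ ⊆ Set.range F := by
    rintro P ⟨hP, a, ha, h⟩
    refine ⟨⟨a, ha⟩, Set.ext fun U => ⟨fun hU => (h U hU.1).2 hU.2, fun hU => ?_⟩⟩
    exact ⟨hP U hU, (h U (hP U hU)).1 hU⟩
  have hA : #A ≤ #(Set.Iio δ → Fin n → Set.Iio δ) := by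
    refine mk_le_of_injective (f := fun a γ i => ⟨f (a.1 γ i), a.2 γ i⟩) fun a a' h => ?_
    refine Subtype.ext (funext fun γ => funext fun i => hf ?_)
    exact congrArg Subtype.val (congrFun (congrFun h γ) i)
  refine (mk_le_mk_of_subset hF).trans (mk_range_le.trans (hA.trans ?_))
  simp only [mk_pi, prod_const, lift_id, mk_fin, lift_natCast, lift_uzero]
  calc (#(Set.Iio δ) ^ (n : Cardinal)) ^ #(Set.Iio δ)
      ≤ #(Set.Iio δ) ^ #(Set.Iio δ) := power_le_power_right (power_nat_le hδ')
    _ = 2 ^ #(Set.Iio δ) := power_self_eq hδ'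

theorem inv5_subset_of_equiv (e : N ≃[L] N') {N₁ : Set N} {N₁' : Set N'} (he : e '' N₁ = N₁')
    {f : N → lam.ord.ToType} {f' : N' → lam.ord.ToType} {δ : lam.ord.ToType}
    (h : ∀ x, f x < δ → f' (e x) < δ) : inv5 φ δ f N₁ ⊆ inv5 φ δ f' N₁' := by
  subst he
  rintro P ⟨hP, a, ha, hPa⟩
  refine ⟨hP, fun γ => e ∘ a γ, fun γ i => h _ (ha γ i), fun U hU => (hPa U hU).trans ?_⟩
  have key : ∀ (γ : Set.Iio δ) (b : Fin m → N),
      φ.Realize (Sum.elim (e ∘ a γ) (e ∘ b)) ↔ φ.Realize (Sum.elim (a γ) b) := fun γ b => by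
    rw [← Sum.comp_elim]; exact e.toElementaryEmbedding.map_formula φ _
  constructor
  · rintro ⟨b, hb, hb'⟩
    exact ⟨e ∘ b, fun i => ⟨_, hb i, rfl⟩, fun γ => (key γ b).trans (hb' γ)⟩
  · rintro ⟨b, hb, hb'⟩
    choose b₀ hb₀ hb₁ using hb
    obtain rfl : e ∘ b₀ = b := funext hb₁
    exact ⟨b₀, hb₀, fun γ => (key γ b₀).symm.trans (hb' γ)⟩

/-- The invariant `inv₆` depends only on the isomorphism type of the pair; in particular it does
not depend on the injection into `lam`. -/
theorem inv6_eq_of_equiv (hreg : lam.IsRegular) (hunc : ℵ₀ < lam) (e : N ≃[L] N') {N₁ : Set N}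
    {N₁' : Set N'} (he : e '' N₁ = N₁') {f : N → lam.ord.ToType} {f' : N' → lam.ord.ToType}
    (hf : Function.Injective f) (hf' : Function.Injective f') : inv6 φ f N₁ = inv6 φ f' N₁' := by
  have hΛ := aleph0_lt_cof_ord_toType hreg hunc
  have hI := mk_Iio_lt_cof_ord_toType hreg
  have h₁ := isClub_setOf_forall_map_lt hΛ hI (Function.extend f (f' ∘ e) id)
  have h₂ := isClub_setOf_forall_map_lt hΛ hI (Function.extend f' (f ∘ e.symm) id)
  refine Filter.Germ.coe_eq.2 ((mem_clubFilter_iff hΛ.ne').2 ⟨_, h₁.inter hΛ.ne' h₂, ?_⟩)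
  rintro δ ⟨hδ₁, hδ₂⟩
  refine Set.Subset.antisymm (inv5_subset_of_equiv φ e he fun x hx => ?_)
    (inv5_subset_of_equiv φ e.symm ?_ fun x hx => ?_)
  · simpa [hf.extend_apply] using hδ₁ _ hx
  · rw [← he, ← Set.image_comp]
    simp
  · simpa [hf'.extend_apply] using hδ₂ _ hx

/-- If the `n`-tuples `a γ` cut out the family `F` of subsets of `lam` by means of the parameters
from `N₁`, then on a club of `δ < lam` the invariant `inv₅` contains the trace of `F` on `δ`. -/
theorem exists_isClub_trace_mem_inv5 (hreg : lam.IsRegular) (hunc : ℵ₀ < lam) {N₁ : Set N}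
    (f : N → lam.ord.ToType) (a : lam.ord.ToType → Fin n → N) {F : Set (Set lam.ord.ToType)}
    (hF : F = {U | ∃ b : Fin m → N, (∀ i, b i ∈ N₁) ∧ U = {γ | φ.Realize (Sum.elim (a γ) b)}}) :
    ∃ C, IsClub C ∧ ∀ δ ∈ C, (fun U => U ∩ Set.Iio δ) '' F ∈ inv5 φ δ f N₁ := by
  have hΛ := aleph0_lt_cof_ord_toType hreg hunc
  refine ⟨_, isClub_setOf_closed hΛ (mk_Iio_lt_cof_ord_toType hreg)
    (fun γ => Set.range fun i => f (a γ i)) fun γ =>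
      (Set.finite_range _).lt_aleph0.trans hΛ, fun δ hδ => ?_⟩
  subst hF
  refine ⟨?_, fun γ => a γ, fun γ i => hδ γ γ.2 _ ⟨i, rfl⟩, fun U hU => ?_⟩
  · rintro _ ⟨U, -, rfl⟩
    exact Set.inter_subset_right
  · constructor
    · rintro ⟨_, ⟨b, hb, rfl⟩, rfl⟩
      exact ⟨b, hb, fun γ => ⟨fun h => ⟨h, γ.2⟩, fun h => h.1⟩⟩
    · rintro ⟨b, hb, h⟩
      refine ⟨_, ⟨b, hb, rfl⟩, Set.ext fun γ => ⟨fun hγ => (h ⟨γ, hγ.2⟩).1 hγ.1, fun hγ => ?_⟩⟩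
      exact ⟨(h ⟨γ, hU hγ⟩).2 hγ, hU hγ⟩

/-- For every pair `(N, N₁)` there is a way `s` of assigning subsets of `lam` to the `m`-tuples of
`N₁` such that a pair `(N', N₁)` has another invariant than `(N, N₁)` as soon as `N'` contains
`n`-tuples `a γ`, `γ < lam`, with `φ(a γ, b) ↔ γ ∈ s b`. The inclusion of `N₁` in the second
model is an arbitrary map `k`.

The family `F` diagonalizes against `inv₅` of `(N, N₁)`, and `s` enumerates it; this is possible as
`N₁` has `lam` many `m`-tuples, `m` being positive. -/
theorem exists_assignment_inv6_ne (hreg : lam.IsRegular) (hunc : ℵ₀ < lam)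
    (hpow : lam ^< lam = lam) (hm : 0 < m) {f : N → lam.ord.ToType} (hf : Function.Injective f)
    {N₁ : Set N} (hN₁ : #N₁ = lam) :
    ∃ s : (Fin m → N₁) → Set lam.ord.ToType,
      ∀ (N' : Type u) [L.Structure N'] (k : N₁ → N') (a : lam.ord.ToType → Fin n → N'),
        (∀ b γ, φ.Realize (Sum.elim (a γ) (k ∘ b)) ↔ γ ∈ s b) →
          ∀ f' : N' → lam.ord.ToType, inv6 φ f N₁ ≠ inv6 φ f' (Set.range k) := by
  have hΛ := aleph0_lt_cof_ord_toType hreg hunc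
  obtain ⟨F, hne, hcard, hF⟩ := exists_family_trace_notMem hΛ (mk_Iio_lt_cof_ord_toType hreg)
    (two_power_mk_Iio_le hunc hpow) (fun δ => inv5 φ δ f N₁) fun δ hδ => mk_inv5_le φ hf N₁ hδ
  obtain ⟨s, hs⟩ : ∃ s : (Fin m → N₁) → F, Function.Surjective s := by
    have : Nonempty F := hne.to_subtype
    have hle : #F ≤ #(Fin m → N₁) := by
      rw [mk_ord_toType] at hcard
      refine hcard.trans (hN₁ ▸ ?_)
      exact mk_le_of_injective (f := fun x _ => x) fun x y h => congrFun h ⟨0, hm⟩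
    obtain ⟨j⟩ := (Cardinal.le_def _ _).1 hle
    exact ⟨Function.invFun j, Function.invFun_surjective j.injective⟩
  refine ⟨fun b => s b, fun N' _ k a ha f' heq => ?_⟩
  obtain ⟨C₁, hC₁, hC₁'⟩ := exists_isClub_trace_mem_inv5 φ hreg hunc (N₁ := Set.range k) f' a
    (F := F) <| by
      ext U
      constructor
      · intro hU
        obtain ⟨b, hb⟩ := hs ⟨U, hU⟩
        exact ⟨k ∘ b, fun i => ⟨_, rfl⟩, Set.ext fun γ => by simp [ha, hb]⟩
      · rintro ⟨b, hb, rfl⟩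
        choose b₀ hb₀ using hb
        obtain rfl : k ∘ b₀ = b := funext hb₀
        have : {γ | φ.Realize (Sum.elim (a γ) (k ∘ b₀))} = (s b₀ : Set lam.ord.ToType) :=
          Set.ext fun γ => ha b₀ γ
        rw [this]
        exact (s b₀).2
  obtain ⟨C₂, hC₂, hC₂'⟩ := (mem_clubFilter_iff hΛ.ne').1 (Filter.Germ.coe_eq.1 heq)
  obtain ⟨δ, ⟨hδ₁, hδ₂⟩, hδ⟩ := hF _ (hC₁.inter hΛ.ne' hC₂)
  have h₂ : inv5 φ δ f N₁ = inv5 φ δ f' (Set.range k) := hC₂' hδ₂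
  exact hδ (h₂ ▸ hC₁' δ hδ₁)

end Invariants

/-! ### Saturation for tuples -/

section Saturation

variable {L : FirstOrder.Language.{u, u}} {M : Type u} [L.Structure M]

theorem definable_setOf_forall_mem_finset {A : Set M} {n : ℕ} (s : Finset (Set (Fin n → M)))
    (hs : ∀ D ∈ s, A.Definable L D) : A.Definable L {v | ∀ D ∈ s, v ∈ D} := by
  have := Set.definable_iInter_of_finite (f := fun D : s => (D : Set (Fin n → M)))
    fun D => hs D D.2
  convert! this using 1
  ext v; simp

/-- In a saturated structure, a family of sets of `n`-tuples that are definable over a common small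
set of parameters has a common point if it has the finite intersection property. The saturation
hypothesis is about `n = 1`; the coordinates are found one at a time. -/
theorem IsSaturated.exists_forall_mem (hM : IsSaturated L M) (hinf : ℵ₀ ≤ #M) {n : ℕ}
    {A : Set M} (hA : #A < #M) (𝒟 : Set (Set (Fin n → M))) (hdef : ∀ D ∈ 𝒟, A.Definable L D)
    (hfip : ∀ s : Finset (Set (Fin n → M)), ↑s ⊆ 𝒟 → ∃ v, ∀ D ∈ s, v ∈ D) :
    ∃ v, ∀ D ∈ 𝒟, v ∈ D := by
  classical
  induction n generalizing A with
  | zero =>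
    refine ⟨default, fun D hD => ?_⟩
    obtain ⟨v, hv⟩ := hfip {D} (by simpa using hD)
    rw [Subsingleton.elim default v]
    exact hv D (Finset.mem_singleton_self D)
  | succ n ih =>
    -- `p` is the type of a first coordinate: the projections of the finite intersections from `𝒟`
    let p : Set (L[[A]].Formula Unit) := {ψ | ∃ s : Finset (Set (Fin (n + 1) → M)), ↑s ⊆ 𝒟 ∧
      ∀ x, ψ.Realize (fun _ => x) ↔ ∃ v, (∀ D ∈ s, v ∈ D) ∧ v 0 = x}
    obtain ⟨x, hx⟩ := hM A hA p fun t ht => by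
      choose! s hs hs' using ht
      obtain ⟨v, hv⟩ := hfip (t.biUnion s) (by simpa using hs)
      exact ⟨v 0, fun ψ hψ => (hs' hψ _).2
        ⟨v, fun D hD => hv D (Finset.mem_biUnion.2 ⟨ψ, hψ, hD⟩), rfl⟩⟩
    have hx' : ∀ s : Finset (Set (Fin (n + 1) → M)), ↑s ⊆ 𝒟 →
        ∃ v, (∀ D ∈ s, v ∈ D) ∧ v 0 = x := by
      intro s hs
      obtain ⟨ψ, hψ⟩ := (definable_setOf_forall_mem_finset s fun D hD => hdef D (hs hD)).image_comp
        (fun _ : Unit => (0 : Fin (n + 1)))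
      have key : ∀ y, ψ.Realize (fun _ => y) ↔ ∃ v, (∀ D ∈ s, v ∈ D) ∧ v 0 = y := by
        intro y
        have := Set.ext_iff.1 hψ fun _ => y
        refine this.symm.trans (exists_congr fun v => and_congr_right fun _ => ?_)
        exact ⟨fun h => congrFun h (), fun h => funext fun _ => h⟩
      exact (key x).1 (hx ψ ⟨s, hs, key⟩)
    -- the fibers over `x` are definable once `x` is a parameter, and keep the intersection property
    let fiber : Set (Fin (n + 1) → M) → Set (Fin n → M) := fun D =>
      (fun v => (Fin.cons x v : Fin (n + 1) → M)) ⁻¹' D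
    have hA' : #(insert x A : Set M) < #M :=
      mk_insert_le.trans_lt (add_lt_of_lt hinf hA (one_lt_aleph0.trans_le hinf))
    obtain ⟨v, hv⟩ := ih hA' (fiber '' 𝒟) (by
      rintro _ ⟨D, hD, rfl⟩
      refine Set.Definable.preimage_map (fun i => ?_) ((hdef D hD).mono (Set.subset_insert x A))
      refine Fin.cases ?_ (fun j => ?_) i
      · exact L.definableFun_const (Fin n) (Set.mem_insert x A)
      · exact Set.DefinableFun.proj L (i := j)) (by
      intro t ht
      obtain ⟨s, hs, rfl⟩ := Finset.subset_set_image_iff.1 ht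
      obtain ⟨v, hv, hv0⟩ := hx' s hs
      refine ⟨Fin.tail v, fun E hE => ?_⟩
      obtain ⟨D, hD, rfl⟩ := Finset.mem_image.1 hE
      simpa [fiber, ← hv0, Fin.cons_self_tail] using hv D hD)
    exact ⟨Fin.cons x v, fun D hD => hv _ ⟨D, hD, rfl⟩⟩

end Saturation

/-! ### Realizing prescribed truth values -/

section StrongIndependence

variable {L : FirstOrder.Language.{u, u}} {T : L.Theory} {n m : ℕ}
  {φ : L.Formula (Fin n ⊕ Fin m)}

theorem HasStrongIndependenceProperty.exists_forall_realize_iff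
    (hφ : HasStrongIndependenceProperty T φ) (N : Type u) [L.Structure N] [N ⊨ T] [Nonempty N]
    (I : Finset (Fin m → N)) (P : (Fin m → N) → Prop) :
    ∃ a : Fin n → N, ∀ b ∈ I, φ.Realize (Sum.elim a b) ↔ P b := by
  classical
  obtain ⟨a, h₁, h₂⟩ := hφ.2 N (I.filter fun b => ¬ P b) (I.filter P)
    (Finset.disjoint_filter_filter_not _ _ _).symm
  refine ⟨a, fun b hb => ⟨fun h => ?_, fun h => h₂ b (Finset.mem_filter.2 ⟨hb, h⟩)⟩⟩
  by_contra hP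
  exact h₁ b (Finset.mem_filter.2 ⟨hb, hP⟩) h

/-- In a saturated model, an arbitrary prescription of truth values of `φ(x̄, b)`, for `b` from a
small set, is realized: strong independence in the model is what makes it finitely satisfiable.
-/
theorem HasStrongIndependenceProperty.exists_realize_iff_of_isSaturated
    (hφ : HasStrongIndependenceProperty T φ) {M : Type u} [L.Structure M] [M ⊨ T]
    (hM : IsSaturated L M) (hinf : ℵ₀ ≤ #M) {A : Set M} (hA : #A < #M)
    (P : (Fin m → M) → Prop) :
    ∃ a : Fin n → M, ∀ b : Fin m → M, (∀ i, b i ∈ A) → (φ.Realize (Sum.elim a b) ↔ P b) := by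
  classical
  have : Nonempty M := mk_ne_zero_iff.1 (aleph0_pos.trans_le hinf).ne'
  let D : (Fin m → M) → Set (Fin n → M) := fun b => {a | φ.Realize (Sum.elim a b) ↔ P b}
  obtain ⟨a, ha⟩ := hM.exists_forall_mem hinf hA (D '' {b | ∀ i, b i ∈ A}) (by
    rintro _ ⟨b, hb, rfl⟩
    have hdef : A.Definable L {a : Fin n → M | φ.Realize (Sum.elim a b)} := by
      have h₀ : A.Definable L {w : Fin n ⊕ Fin m → M | φ.Realize w} :=
        (Set.empty_definable_iff.2 ⟨φ, rfl⟩).mono (Set.empty_subset A)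
      refine Set.Definable.preimage_map (F := fun a => Sum.elim a b) (fun i => ?_) h₀
      rcases i with i | i
      · exact Set.DefinableFun.proj L (i := i)
      · exact L.definableFun_const (Fin n) (hb i)
    by_cases h : P b
    · simpa [D, h] using hdef
    · simpa [D, h] using! hdef.compl) (by
    intro t ht
    obtain ⟨I, hI, rfl⟩ := Finset.subset_set_image_iff.1 ht
    obtain ⟨a, ha⟩ := hφ.exists_forall_realize_iff M I P
    refine ⟨a, fun E hE => ?_⟩
    obtain ⟨b, hb, rfl⟩ := Finset.mem_image.1 hE
    exact ha b hb)
  exact ⟨a, fun b hb => ha _ ⟨b, hb, rfl⟩⟩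

/-- The diagonal embedding of a structure into its ultrapower. -/
noncomputable def ultrapowerDiagonal (N : Type u) [L.Structure N] [Nonempty N] {ι : Type u}
    (𝒰 : Ultrafilter ι) : N ↪ₑ[L] (𝒰 : Filter ι).Product fun _ => N where
  toFun x := ((fun _ => x : ι → N) : (𝒰 : Filter ι).Product fun _ => N)
  map_formula' k ψ x := by
    have := Language.Ultraproduct.realize_formula_cast (u := 𝒰) (M := fun _ => N) (φ := ψ)
      (x := fun i _ => x i)
    exact this.trans (by simp)

/-- Every model `N` has an elementary extension in which any `|N|` many prescriptions of truth
values of `φ(x̄, b)`, for `b` from `N`, are realized.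

The tuples are found in the ultrapower of `N` over the finite sets of `m`-tuples of `N`, by means of
an ultrafilter that contains the cone of every `b`; the downward Löwenheim–Skolem theorem then cuts
the extension down to the cardinality of `N`. -/
theorem HasStrongIndependenceProperty.exists_elementaryEmbedding_realize_iff
    (hφ : HasStrongIndependenceProperty T φ) (N : Type u) [L.Structure N] [N ⊨ T]
    (hN : ℵ₀ ≤ #N) (hL : L.card ≤ #N) {Γ : Type u} (hΓ : #Γ ≤ #N)
    (P : Γ → (Fin m → N) → Prop) :
    ∃ (N' : Type u) (_ : L.Structure N') (j : N ↪ₑ[L] N') (a : Γ → Fin n → N'),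
      #N' = #N ∧ ∀ γ b, φ.Realize (Sum.elim (a γ) (j ∘ b)) ↔ P γ b := by
  classical
  have : Nonempty N := mk_ne_zero_iff.1 (aleph0_pos.trans_le hN).ne'
  choose t ht using fun (I : Finset (Fin m → N)) γ => hφ.exists_forall_realize_iff N I (P γ)
  let 𝒰 : Ultrafilter (Finset (Fin m → N)) := Ultrafilter.of Filter.atTop
  let W := (𝒰 : Filter (Finset (Fin m → N))).Product fun _ => N
  let d : N ↪ₑ[L] W := ultrapowerDiagonal N 𝒰
  let a : Γ → Fin n → W := fun γ i => ((fun I => t I γ i : Finset (Fin m → N) → N) : W)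
  have ha : ∀ γ b, φ.Realize (Sum.elim (a γ) (d ∘ b)) ↔ P γ b := by
    intro γ b
    have h := Language.Ultraproduct.realize_formula_cast (u := 𝒰) (M := fun _ => N) (φ := φ)
      (x := Sum.elim (fun i I => t I γ i) (fun i _ => b i))
    have h₁ : (fun i => ((Sum.elim (fun i I => t I γ i) (fun i _ => b i) : Fin n ⊕ Fin m →
        Finset (Fin m → N) → N) i : W)) = Sum.elim (a γ) (d ∘ b) := by
      ext i; rcases i with i | i <;> rfl
    have h₂ : ∀ᶠ I in (𝒰 : Filter (Finset (Fin m → N))),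
        (φ.Realize (fun i => (Sum.elim (fun i I => t I γ i) (fun i _ => b i) : Fin n ⊕ Fin m →
          Finset (Fin m → N) → N) i I) ↔ P γ b) := by
      refine Ultrafilter.of_le _ (Filter.eventually_atTop.2 ⟨{b}, fun I hI => ?_⟩)
      rw [← ht I γ b (hI (Finset.mem_singleton_self b))]
      refine iff_of_eq (congrArg _ (funext fun i => ?_))
      rcases i with i | i <;> rfl
    rw [← h₁]
    refine h.trans ((Filter.eventually_congr h₂).trans (by simp))
  have hdW : #N ≤ #W := mk_le_of_injective d.injective
  let s : Set W := Set.range d ∪ Set.range fun x : Γ × Fin n => a x.1 x.2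
  have hs : #s ≤ #N := by
    refine (mk_union_le _ _).trans (add_le_of_le hN mk_range_le (mk_range_le.trans ?_))
    simp only [mk_prod, lift_uzero, mk_fin, lift_natCast]
    exact mul_le_of_le hN hΓ ((natCast_lt_aleph0).le.trans hN)
  obtain ⟨S, hsS, hS⟩ := Language.exists_elementarySubstructure_card_eq L s (#N) hN
    (by simpa using hs) (by simpa using hL) (by simpa using hdW)
  have hdS : ∀ x, d x ∈ S := fun x => hsS (Or.inl ⟨x, rfl⟩)
  have haS : ∀ γ i, a γ i ∈ S := fun γ i => hsS (Or.inr ⟨(γ, i), rfl⟩)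
  refine ⟨S, inferInstance, ⟨fun x => ⟨d x, hdS x⟩, fun k ψ x => ?_⟩,
    fun γ i => ⟨a γ i, haS γ i⟩, by simpa using hS, fun γ b => ?_⟩
  · rw [← S.subtype.map_formula]
    exact d.map_formula ψ x
  · rw [← S.subtype.map_formula, Sum.comp_elim]
    exact ha γ b

end StrongIndependence

/-! ### Filtrations of saturated models -/

section Filtration

variable {L : FirstOrder.Language.{u, u}} {T : L.Theory} {n m : ℕ}
  {φ : L.Formula (Fin n ⊕ Fin m)} {lam : Cardinal.{u}}

theorem exists_injective_ord_toType {N : Type u} (hN : #N = lam) :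
    ∃ f : N → lam.ord.ToType, Function.Injective f := by
  obtain ⟨j⟩ := (Cardinal.le_def N lam.ord.ToType).1 (by rw [mk_ord_toType, hN])
  exact ⟨j, j.injective⟩

theorem mk_within {M : Type u} [L.Structure M] {A B : L.ElementarySubstructure M}
    (h : (A : Set M) ⊆ B) : #(within A B) = #A :=
  mk_congr
    { toFun := fun x => ⟨x.1, x.2⟩
      invFun := fun x => ⟨⟨x, h x.2⟩, x.2⟩ }

variable {M : Type u} [L.Structure M]
  {Mc : (succ lam).ord.ToType → L.ElementarySubstructure M}

/-- In a filtration of a saturated model, `inv₆` of the pair `(M_ζ, M_α)` differs from that of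
`(M_β, M_α)` once `ζ` is large enough, depending on `α` and `β`. -/
theorem exists_forall_inv6_ne [M ⊨ T] (hreg : lam.IsRegular) (hunc : ℵ₀ < lam)
    (hpow : lam ^< lam = lam) (hφ : HasStrongIndependenceProperty T φ) (hcard : #M = succ lam)
    (hM : IsSaturated L M) (hMc : IsFiltration lam Mc) {α β : (succ lam).ord.ToType} (hαβ : α < β) :
    ∃ ξ, ∀ ζ, ξ < ζ → α < ζ →
      ∀ (f : Mc β → lam.ord.ToType) (f' : Mc ζ → lam.ord.ToType), Function.Injective f →
        inv6 φ f (within (Mc α) (Mc β)) ≠ inv6 φ f' (within (Mc α) (Mc ζ)) := by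
  have hinc := hMc.increasing α β hαβ.le
  obtain ⟨f₀, hf₀⟩ := exists_injective_ord_toType (hMc.card_eq β)
  obtain ⟨s, hs⟩ := exists_assignment_inv6_ne φ hreg hunc hpow hφ.1 hf₀
    ((mk_within hinc).trans (hMc.card_eq α))
  have hex : ∀ γ, ∃ a : Fin n → M, ∀ b : Fin m → M, (∀ i, b i ∈ (Mc α : Set M)) →
      (φ.Realize (Sum.elim a b) ↔ ∃ h : ∀ i, b i ∈ (Mc α : Set M),
        γ ∈ s fun i => ⟨⟨b i, hinc (h i)⟩, h i⟩) := fun γ =>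
    hφ.exists_realize_iff_of_isSaturated hM (by rw [hcard]; exact hunc.le.trans (le_succ lam))
      (by rw [hcard]; exact (hMc.card_eq α).trans_lt (lt_succ lam)) _
  choose a ha using hex
  -- the tuples `a γ` are at most `lam` many, so they all lie in some `M_ξ`
  have hmem : ∀ x : M, ∃ ξ, x ∈ Mc ξ := fun x => by
    have : x ∈ ⋃ ξ, (Mc ξ : Set M) := hMc.union_eq ▸ Set.mem_univ x
    simpa using this
  choose rk hrk using hmem
  obtain ⟨ξ, hξ⟩ := exists_forall_lt_of_mk_lt_cof
    (s := Set.range fun p : lam.ord.ToType × Fin n => rk (a p.1 p.2)) (by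
      rw [cof_ord_toType (isRegular_succ hunc.le), lt_succ_iff]
      refine mk_range_le.trans ?_
      simp only [mk_prod, lift_uzero, mk_fin, lift_natCast, mk_ord_toType]
      exact mul_le_of_le hunc.le le_rfl ((natCast_lt_aleph0).le.trans hunc.le))
  refine ⟨ξ, fun ζ hζ hαζ f f' hf => ?_⟩
  have haζ : ∀ γ i, a γ i ∈ (Mc ζ : Set M) := fun γ i =>
    hMc.increasing _ _ ((hξ _ ⟨(γ, i), rfl⟩).trans hζ).le (hrk (a γ i))
  have hincζ := hMc.increasing α ζ hαζ.le
  let k : within (Mc α) (Mc β) → Mc ζ := fun x => ⟨x.1, hincζ x.2⟩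
  have hk : Set.range k = within (Mc α) (Mc ζ) := by
    ext x
    constructor
    · rintro ⟨y, rfl⟩
      exact y.2
    · intro hx
      exact ⟨⟨⟨x, hinc hx⟩, hx⟩, rfl⟩
  rw [inv6_eq_of_equiv φ hreg hunc (.refl L (Mc β)) (N₁ := within (Mc α) (Mc β))
    (Set.image_id _) hf hf₀, ← hk]
  refine hs _ k (fun γ i => ⟨a γ i, haζ γ i⟩) (fun b γ => ?_) f'
  rw [← (Mc ζ).subtype.map_formula, Sum.comp_elim]
  refine (ha γ _ fun i => (b i).2).trans ⟨fun ⟨_, h⟩ => h, fun h => ⟨fun i => (b i).2, h⟩⟩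

/-- The club consists of the `δ` that bound, for all `α < β < δ`, the `ξ` found for `α` and `β`. -/
theorem exists_isClub_inv6_ne [M ⊨ T] (hreg : lam.IsRegular) (hunc : ℵ₀ < lam)
    (hpow : lam ^< lam = lam) (hφ : HasStrongIndependenceProperty T φ) (hcard : #M = succ lam)
    (hM : IsSaturated L M) (hMc : IsFiltration lam Mc) :
    ∃ E : Set (succ lam).ord.ToType, IsClub E ∧ ∀ δ₁ δ₂ δ₃, δ₃ ∈ E → δ₁ < δ₂ → δ₂ < δ₃ →
      ∀ (f₂ : Mc δ₂ → lam.ord.ToType) (f₃ : Mc δ₃ → lam.ord.ToType), Function.Injective f₂ →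
        inv6 φ f₂ (within (Mc δ₁) (Mc δ₂)) ≠ inv6 φ f₃ (within (Mc δ₁) (Mc δ₃)) := by
  have hreg' := isRegular_succ hunc.le
  choose ξ hξ using fun (β : (succ lam).ord.ToType) (α : Set.Iio β) =>
    exists_forall_inv6_ne hreg hunc hpow hφ hcard hM hMc α.2
  refine ⟨_, isClub_setOf_closed
    (aleph0_lt_cof_ord_toType hreg' (hunc.trans (lt_succ lam))) (mk_Iio_lt_cof_ord_toType hreg')
    (fun β => Set.range (ξ β)) fun β => mk_range_le.trans_lt (mk_Iio_lt_cof_ord_toType hreg' β),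
    fun δ₁ δ₂ δ₃ hδ₃ h₁₂ h₂₃ f₂ f₃ hf₂ => ?_⟩
  exact hξ δ₂ ⟨δ₁, h₁₂⟩ δ₃ (hδ₃ δ₂ h₂₃ _ ⟨_, rfl⟩) (h₁₂.trans h₂₃) f₂ f₃ hf₂

/-- A club of `lam⁺` contains `δ₁ < δ₂ < δ₃` of cofinality `lam`; so the generic pair property
fails if `(M_{δ₂}, M_{δ₁})` and `(M_{δ₃}, M_{δ₁})` are never isomorphic for such triples. -/
theorem not_genericPairProperty (hreg : lam.IsRegular) {E : Set (succ lam).ord.ToType}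
    (hE : IsClub E) (h : ∀ δ₁ ∈ E, ∀ δ₂ ∈ E, ∀ δ₃ ∈ E, δ₁ < δ₂ → δ₂ < δ₃ →
      cof (Set.Iio δ₁) = lam → cof (Set.Iio δ₂) = lam → cof (Set.Iio δ₃) = lam →
        ¬ PairIso L (Mc δ₂) (Mc δ₃) (within (Mc δ₁) (Mc δ₂)) (within (Mc δ₁) (Mc δ₃))) :
    ¬ GenericPairProperty lam Mc := by
  rintro ⟨E', hE', h'⟩
  have hreg' := isRegular_succ hreg.aleph0_le
  have hΛ : ℵ₀ < cof (succ lam).ord.ToType :=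
    aleph0_lt_cof_ord_toType hreg' (hreg.aleph0_le.trans_lt (lt_succ lam))
  have hΛ' : #lam.ord.ToType < cof (succ lam).ord.ToType := by
    rw [cof_ord_toType hreg', mk_ord_toType]
    exact lt_succ lam
  have : NoMaxOrder lam.ord.ToType := noMaxOrder hreg.aleph0_le
  have : Nonempty lam.ord.ToType := by
    rw [← mk_ne_zero_iff, mk_ord_toType]; exact hreg.ne_zero
  have : Nonempty (succ lam).ord.ToType := by
    rw [← mk_ne_zero_iff, mk_ord_toType]; exact hreg'.ne_zero
  have step := fun a => exists_mem_isClub_cof_Iio_eq (K := lam.ord.ToType) hΛ hΛ'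
    (hE.inter hΛ.ne' hE') a
  rw [cof_ord_toType hreg] at step
  obtain ⟨δ₁, ⟨h₁, h₁'⟩, -, hc₁⟩ := step (Classical.arbitrary _)
  obtain ⟨δ₂, ⟨h₂, h₂'⟩, h₁₂, hc₂⟩ := step δ₁
  obtain ⟨δ₃, ⟨h₃, h₃'⟩, h₂₃, hc₃⟩ := step δ₂
  exact h δ₁ h₁ δ₂ h₂ δ₃ h₃ h₁₂ h₂₃ hc₁ hc₂ hc₃
    (h' δ₁ h₁' δ₂ h₂' δ₁ h₁' δ₃ h₃' h₁₂ (h₁₂.trans h₂₃) hc₁ hc₂ hc₁ hc₃)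

end Filtration

/-! ### Elementary extensions -/

section ElementaryExtension

variable {L : FirstOrder.Language.{u, u}} {T : L.Theory} {n m : ℕ}
  {φ : L.Formula (Fin n ⊕ Fin m)} {lam : Cardinal.{u}}

/-- The extension `N₁` contains tuples that give every pair `(N₂, M)` with `N₁ ≺ N₂` an invariant
different from that of `(N₀, M)`. -/
theorem exists_extension_forall_not_pairIso (hreg : lam.IsRegular) (hunc : ℵ₀ < lam)
    (hpow : lam ^< lam = lam) (hL : L.card ≤ lam) (hφ : HasStrongIndependenceProperty T φ)
    {N₀ : Type u} [L.Structure N₀] [N₀ ⊨ T] (M : L.ElementarySubstructure N₀) (hN₀ : #N₀ = lam)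
    (hM : #M = lam) :
    ∃ (N₁ : Type u) (_ : L.Structure N₁) (j : N₀ ↪ₑ[L] N₁), N₁ ⊨ T ∧ #N₁ = lam ∧
      ∀ (N₂ : Type u) [L.Structure N₂] (k : N₁ ↪ₑ[L] N₂), #N₂ = lam →
        ¬ PairIso L N₀ N₂ (M : Set N₀) (k ∘ j '' (M : Set N₀)) := by
  obtain ⟨f₀, hf₀⟩ := exists_injective_ord_toType hN₀
  obtain ⟨s, hs⟩ := exists_assignment_inv6_ne φ hreg hunc hpow hφ.1 hf₀ (N₁ := (M : Set N₀)) hM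
  obtain ⟨N₁, _, j, a, hN₁, ha⟩ := hφ.exists_elementaryEmbedding_realize_iff N₀
    (hN₀ ▸ hunc.le) (hN₀ ▸ hL) (Γ := lam.ord.ToType) (by rw [mk_ord_toType, hN₀])
    fun γ b => ∃ h : ∀ i, b i ∈ (M : Set N₀), γ ∈ s fun i => ⟨b i, h i⟩
  refine ⟨N₁, inferInstance, j, (j.theory_model_iff T).1 inferInstance, hN₁.trans hN₀,
    fun N₂ _ k hN₂ => ?_⟩
  rintro ⟨e, he⟩
  obtain ⟨f₂, hf₂⟩ := exists_injective_ord_toType hN₂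
  refine hs N₂ (fun x => k (j x)) (fun γ => k ∘ a γ) (fun b γ => ?_) f₂
    (inv6_eq_of_equiv φ hreg hunc e (he.trans ?_) hf₀ hf₂)
  · have h₁ := k.map_formula φ (Sum.elim (a γ) (j ∘ fun i => (b i : N₀)))
    rw [Sum.comp_elim] at h₁
    refine (h₁.trans (ha γ _)).trans ⟨fun ⟨_, h⟩ => h, fun h => ⟨fun i => (b i).2, h⟩⟩
  · rw [Set.image_eq_range]
    rfl

end ElementaryExtension

end GenericPair

open GenericPair in
theorem theorem1p10 {L : FirstOrder.Language.{u, u}} (T : L.Theory) (hT : T.IsComplete)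
    (hSI : StronglyIndependent T) (lam : Cardinal.{u}) (hreg : lam.IsRegular) (hunc : ℵ₀ < lam)
    (hpow : lam ^< lam = lam) (hcard : L.card < lam) (hsucc : succ lam = 2 ^ lam) :
    -- part (1), for a filtration of a saturated model of cardinality `lam⁺`
    (∀ (M : Type u) [L.Structure M] [M ⊨ T], #M = succ lam → IsSaturated L M →
      ∀ Mc : (succ lam).ord.ToType → L.ElementarySubstructure M, IsFiltration lam Mc →
        (∃ (n m : ℕ) (φ : L.Formula (Fin n ⊕ Fin m)), HasStrongIndependenceProperty T φ ∧
          ∃ E : Set (succ lam).ord.ToType, IsClub E ∧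
            ∀ δ₁ ∈ E, ∀ δ₂ ∈ E, ∀ δ₃ ∈ E, δ₁ < δ₂ → δ₂ < δ₃ →
              cof (Set.Iio δ₁) = lam → cof (Set.Iio δ₂) = lam → cof (Set.Iio δ₃) = lam →
                ¬ PairIso L (Mc δ₂) (Mc δ₃) (within (Mc δ₁) (Mc δ₂)) (within (Mc δ₁) (Mc δ₃)) ∧
                ∀ (f₂ : Mc δ₂ → lam.ord.ToType) (f₃ : Mc δ₃ → lam.ord.ToType),
                  Function.Injective f₂ → Function.Injective f₃ →
                    inv6 φ f₂ (within (Mc δ₁) (Mc δ₂)) ≠ inv6 φ f₃ (within (Mc δ₁) (Mc δ₃))) ∧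
        ¬ GenericPairProperty lam Mc) ∧
    -- part (2)
    (∀ (N₀ : Type u) [L.Structure N₀] [N₀ ⊨ T] (M : L.ElementarySubstructure N₀),
      #N₀ = lam → #M = lam →
        ∃ (N₁ : Type u) (_ : L.Structure N₁) (j : N₀ ↪ₑ[L] N₁), N₁ ⊨ T ∧ #N₁ = lam ∧
          ∀ (N₂ : Type u) [L.Structure N₂] [N₂ ⊨ T] (k : N₁ ↪ₑ[L] N₂), #N₂ = lam →
            ¬ PairIso L N₀ N₂ (M : Set N₀) (k ∘ j '' (M : Set N₀))) := by
  obtain ⟨n, m, φ, hφ⟩ := hSI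
  refine ⟨fun M _ _ hM hsat Mc hMc => ?_, fun N₀ _ _ M hN₀ hM => ?_⟩
  · obtain ⟨E, hE, h⟩ := exists_isClub_inv6_ne hreg hunc hpow hφ hM hsat hMc
    have hiso : ∀ δ₁ δ₂ δ₃, δ₃ ∈ E → δ₁ < δ₂ → δ₂ < δ₃ →
        ¬ PairIso L (Mc δ₂) (Mc δ₃) (within (Mc δ₁) (Mc δ₂)) (within (Mc δ₁) (Mc δ₃)) := by
      rintro δ₁ δ₂ δ₃ h₃ h₁₂ h₂₃ ⟨e, he⟩
      obtain ⟨f₂, hf₂⟩ := exists_injective_ord_toType (hMc.card_eq δ₂)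
      obtain ⟨f₃, hf₃⟩ := exists_injective_ord_toType (hMc.card_eq δ₃)
      exact h δ₁ δ₂ δ₃ h₃ h₁₂ h₂₃ f₂ f₃ hf₂ (inv6_eq_of_equiv φ hreg hunc e he hf₂ hf₃)
    exact ⟨⟨n, m, φ, hφ, E, hE, fun δ₁ _ δ₂ _ δ₃ h₃ h₁₂ h₂₃ _ _ _ =>
        ⟨hiso δ₁ δ₂ δ₃ h₃ h₁₂ h₂₃, fun f₂ f₃ hf₂ _ => h δ₁ δ₂ δ₃ h₃ h₁₂ h₂₃ f₂ f₃ hf₂⟩⟩,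
      not_genericPairProperty hreg hE fun δ₁ _ δ₂ _ δ₃ h₃ h₁₂ h₂₃ _ _ _ =>
        hiso δ₁ δ₂ δ₃ h₃ h₁₂ h₂₃⟩
  · obtain ⟨N₁, i₁, j, hT₁, hN₁, h⟩ :=
      exists_extension_forall_not_pairIso hreg hunc hpow hcard.le hφ M hN₀ hM
    exact ⟨N₁, i₁, j, hT₁, hN₁, fun N₂ _ _ k hN₂ => h N₂ k hN₂⟩
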